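/- A \emph{transcendental Hénon map} is a map $F\colon\mathbb C^2\to\mathbb C^2$ of the form $F(z,w)=(f(z)-\delta w,\,z)$, where $f\colon\mathbb C\to\mathbb C$ is an entire function that is not a polynomial and $\delta\in\mathbb C\setminus\{0\}$. A point $p$ is a \emph{periodic point of order $n$} of $F$ if $n\ge 1$ is the least positive integer with $F^n(p)=p$. \begin{enumerate} \item Every transcendental Hénon map has a periodic orbit; in fact it has a periodic point of order $1$, $2$ or $4$. \item Let $g\colon\mathbb C\to\mathbb C$ be a non-constant entire function and let $F(z,w)=(e^{g(z)}+w,\,z)$. Then $F$ has infinitely many periodic points of order $4$. \end{enumerate} -/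

import Mathlib

/-- An entire function is transcendental if it is not a polynomial function. -/
def IsTranscendentalEntire (f : ℂ → ℂ) : Prop :=
  Differentiable ℂ f ∧ ¬ ∃ P : Polynomial ℂ, ∀ z : ℂ, f z = P.eval z

/-- The map `(z, w) ↦ (f z - δ w, z)` of `ℂ²`. -/
def henonMap (f : ℂ → ℂ) (δ : ℂ) : ℂ × ℂ → ℂ × ℂ :=
  fun p => (f p.1 - δ * p.2, p.1)

/-- Transcendental Hénon maps: `(z, w) ↦ (f z - δ w, z)` with `f` entire transcendental and
`δ ≠ 0` (so that the map is an automorphism of `ℂ²`). -/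
def IsTranscendentalHenon (F : ℂ × ℂ → ℂ × ℂ) : Prop :=
  ∃ (f : ℂ → ℂ) (δ : ℂ), IsTranscendentalEntire f ∧ δ ≠ 0 ∧ F = henonMap f δ

/-! A fixed point of `henonMap f δ` is a point (z, z) with f(z) = (1 + δ)z. If there is none, f(z) =
(1 + δ)z + exp(g(z)) with g entire and nonconstant. Raising g by πi flips the sign of exp ∘ g. So
for δ ≠ -1 a 2-cycle (x, y), (y, x) arises from g(y) = g(x) + πi and (1 + δ)(y - x) = exp(g(x)). For
δ = -1 a coupled pair of such equations gives a 4-cycle.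

To solve them, take an inverse branch φ of g - g(0) on a disc of radius T/40 about iT, and put x =
φ(X), y = φ(X + πi). The equation becomes φ(X + πi) - φ(X) = C exp(X). The left side never vanishes,
so it equals C exp(h(X)). Polynomial bounds in T on φ and on the difference at the centre make h
vary by only O(log T), and a choice of logarithm puts h(iT) within O(log T) of iT. Hence h contracts
a disc of radius T/100, and its fixed point solves the equation. The coupled pair uses a composite
h₂ ∘ h₁ (`exists_log_difference`, `exists_solutions`).

The branch comes from a Wiman–Valiron type argument (`exists_max_weighted_norm`,
`exists_large_inverse_branch`): at a maximum z of |g| log(R/|z|)^n, the function g behaves like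
g(z)e^u in a rescaled logarithmic coordinate u, and e^u is explicitly invertible. -/

/-! ### Holomorphic logarithms -/

open Complex Metric Set Filter in
/-- A nowhere vanishing holomorphic function on a preconnected open set on which its logarithmic
derivative has a primitive is the exponential of a holomorphic function. -/
theorem exists_exp_eq_of_isExactOn {f : ℂ → ℂ} {U : Set ℂ} (hU : IsOpen U)
    (hU' : IsPreconnected U) (hf : DifferentiableOn ℂ f U) (h0 : ∀ z ∈ U, f z ≠ 0)
    (hex : IsExactOn (fun z => deriv f z / f z) U) {c : ℂ} (hc : c ∈ U) :
    ∃ h : ℂ → ℂ, DifferentiableOn ℂ h U ∧ ∀ z ∈ U, exp (h z) = f z := by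
  obtain ⟨p, hp⟩ := hex
  have hder : ∀ z ∈ U, HasDerivAt (fun z => f z * exp (-p z)) 0 z := by
    intro z hz
    have h1 := (hf.differentiableAt (hU.mem_nhds hz)).hasDerivAt
    refine (h1.mul (hp z hz).neg.cexp).congr_deriv ?_
    have := h0 z hz
    field_simp
    ring
  have hconst : ∀ z ∈ U, f z * exp (-p z) = f c * exp (-p c) := by
    intro z hz
    refine hU.is_const_of_deriv_eq_zero hU'
      (fun w hw => (hder w hw).differentiableAt.differentiableWithinAt)
      (fun w hw => (hder w hw).deriv) hz hc
  have hne : f c * exp (-p c) ≠ 0 := mul_ne_zero (h0 c hc) (exp_ne_zero _)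
  refine ⟨fun z => p z + log (f c * exp (-p c)), fun z hz =>
    ((hp z hz).differentiableAt.add_const _).differentiableWithinAt, fun z hz => ?_⟩
  rw [exp_add, exp_log hne, ← hconst z hz, exp_neg]
  field_simp [exp_ne_zero]

open Complex Metric in
theorem exists_exp_eq_on_ball {f : ℂ → ℂ} {c : ℂ} {r : ℝ} (hr : 0 < r)
    (hf : DifferentiableOn ℂ f (ball c r)) (h0 : ∀ z ∈ ball c r, f z ≠ 0) :
    ∃ h : ℂ → ℂ, DifferentiableOn ℂ h (ball c r) ∧ ∀ z ∈ ball c r, exp (h z) = f z :=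
  exists_exp_eq_of_isExactOn isOpen_ball (convex_ball c r).isPreconnected hf h0
    (((hf.deriv isOpen_ball).div hf h0).isExactOn_ball) (mem_ball_self hr)

open Complex in
theorem exists_exp_eq_of_entire {f : ℂ → ℂ} (hf : Differentiable ℂ f) (h0 : ∀ z, f z ≠ 0) :
    ∃ h : ℂ → ℂ, Differentiable ℂ h ∧ ∀ z, exp (h z) = f z := by
  have hd : Differentiable ℂ (fun z => deriv f z / f z) := by
    have := hf.deriv
    exact fun z => (this z).div (hf z) (h0 z)
  obtain ⟨h, h1, h2⟩ := exists_exp_eq_of_isExactOn isOpen_univ isPreconnected_univ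
    hf.differentiableOn (fun z _ => h0 z) hd.isExactOn_univ (Set.mem_univ 0)
  exact ⟨h, differentiableOn_univ.1 h1, fun z => h2 z (Set.mem_univ z)⟩

/-! ### Fixed points and quantitative inversion on discs -/

open Complex Metric Set in
/-- A holomorphic map of a disc into a much smaller concentric disc has a fixed point. -/
theorem exists_fixedPoint_of_mapsTo_ball {h : ℂ → ℂ} {c : ℂ} {r : ℝ} (hr : 0 < r)
    (hd : DifferentiableOn ℂ h (ball c r)) (hm : MapsTo h (ball c r) (closedBall c (r / 8))) :
    ∃ x ∈ closedBall c (r / 8), h x = x := by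
  have hsub : closedBall c (r / 8) ⊆ ball c r := closedBall_subset_ball (by linarith)
  have hm' : MapsTo h (closedBall c (r / 8)) (closedBall c (r / 8)) := hm.mono_left hsub
  -- On the disc of radius r/2 about x, `h` stays within r/4 of `h x`; the Schwarz lemma then gives
  -- derivative at most 1/2.
  have hder : ∀ x ∈ closedBall c (r / 8), ‖deriv h x‖₊ ≤ (1 / 2 : NNReal) := by
    intro x hx
    have hb : ball x (r / 2) ⊆ ball c r := by
      refine ball_subset_ball' ?_
      rw [mem_closedBall] at hx
      linarith
    have h1 : MapsTo h (ball x (r / 2)) (closedBall (h x) (r / 4)) := by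
      intro y hy
      have h2 := hm (hb hy)
      have h3 := hm' hx
      rw [mem_closedBall] at *
      calc dist (h y) (h x) ≤ dist (h y) c + dist (h x) c := dist_triangle_right _ _ _
        _ ≤ r / 4 := by linarith
    have h4 := norm_deriv_le_div_of_mapsTo_ball (hd.mono hb) h1 (by positivity)
    have h5 : r / 4 / (r / 2) = 1 / 2 := by field_simp; norm_num
    rw [h5] at h4
    exact_mod_cast h4
  have hlip : LipschitzOnWith (1 / 2) h (closedBall c (r / 8)) :=
    (convex_closedBall c _).lipschitzOnWith_of_nnnorm_deriv_le
      (fun x hx => hd.differentiableAt (isOpen_ball.mem_nhds (hsub hx))) hder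
  have hcon : ContractingWith (1 / 2) (hm'.restrict h _ _) := by
    refine ⟨by norm_num, ?_⟩
    exact hlip.mapsToRestrict hm'
  obtain ⟨y, hy, hfix, -⟩ := hcon.exists_fixedPoint' (isClosed_closedBall.isComplete) hm'
    (mem_closedBall_self (by positivity)) (edist_ne_top _ _)
  exact ⟨y, hy, hfix⟩

open Complex Metric Set in
/-- A quantitative inverse function theorem for holomorphic functions on a disc. -/
theorem exists_holomorphic_inverse {P : ℂ → ℂ} {u₀ a : ℂ} {r : ℝ} (ha : a ≠ 0)
    (hP : DifferentiableOn ℂ P (ball u₀ r))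
    (hder : ∀ u ∈ ball u₀ r, ‖deriv P u - a‖ ≤ ‖a‖ / 2) :
    ∃ ψ : ℂ → ℂ, DifferentiableOn ℂ ψ (ball (P u₀) (‖a‖ * r / 2)) ∧
      ∀ w ∈ ball (P u₀) (‖a‖ * r / 2), ψ w ∈ ball u₀ r ∧ P (ψ w) = w ∧
        ∀ w' ∈ ball (P u₀) (‖a‖ * r / 2),
          ‖w - w' - a * (ψ w - ψ w')‖ ≤ ‖a‖ / 2 * ‖ψ w - ψ w'‖ := by
  have happ : ∀ x ∈ ball u₀ r, ∀ y ∈ ball u₀ r,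
      ‖P x - P y - a * (x - y)‖ ≤ ‖a‖ / 2 * ‖x - y‖ := by
    intro x hx y hy
    have h1 : ∀ u ∈ ball u₀ r, HasDerivWithinAt (fun u => P u - a * u) (deriv P u - a)
        (ball u₀ r) u := by
      intro u hu
      have := (hP.differentiableAt (isOpen_ball.mem_nhds hu)).hasDerivAt
      have h2 : HasDerivAt (fun u => a * u) a u := by
        simpa using (hasDerivAt_id u).const_mul a
      exact (this.sub h2).hasDerivWithinAt
    have := (convex_ball u₀ r).norm_image_sub_le_of_norm_hasDerivWithin_le h1 hder hy hx
    have h3 : P x - P y - a * (x - y) = P x - a * x - (P y - a * y) := by ring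
    rw [h3]
    exact this
  let e : ℂ ≃L[ℂ] ℂ := ContinuousLinearEquiv.unitsEquivAut ℂ (Units.mk0 a ha)
  have he : ∀ x, e x = x * a := fun x => by simp [e]
  have hes : ∀ x, e.symm x = x * a⁻¹ := fun x => by simp [e]
  have hA : ApproximatesLinearOn P (e : ℂ →L[ℂ] ℂ) (ball u₀ r) (‖a‖₊ / 2) := by
    intro x hx y hy
    have := happ x hx y hy
    simp only [ContinuousLinearEquiv.coe_coe, he]
    rw [mul_comm (x - y) a]
    simpa using this
  have hN : ‖(e.symm : ℂ →L[ℂ] ℂ)‖₊⁻¹ = ‖a‖₊ := by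
    have : (e.symm : ℂ →L[ℂ] ℂ) = ContinuousLinearMap.toSpanSingleton ℂ a⁻¹ := by
      ext; simp [hes]
    rw [this]
    apply NNReal.eq
    simp
  have hapos : 0 < ‖a‖ := norm_pos_iff.2 ha
  have hc : Subsingleton ℂ ∨ ‖a‖₊ / 2 < ‖(e.symm : ℂ →L[ℂ] ℂ)‖₊⁻¹ := by
    right
    rw [hN]
    exact NNReal.half_lt_self (by simpa using ha)
  let Φ := hA.toOpenPartialHomeomorph P (ball u₀ r) hc isOpen_ball
  have hΦ : (Φ : ℂ → ℂ) = P := rfl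
  have hsrc : Φ.source = ball u₀ r := rfl
  have htgt : ball (P u₀) (‖a‖ * r / 2) ⊆ Φ.target := by
    intro w hw
    rw [mem_ball] at hw
    have hε : 2 * dist w (P u₀) / ‖a‖ < r := by
      rw [div_lt_iff₀ hapos]; linarith
    refine hA.closedBall_subset_target hc isOpen_ball (b := u₀)
      (ε := 2 * dist w (P u₀) / ‖a‖) (by positivity) (closedBall_subset_ball hε) ?_
    rw [hN, mem_closedBall]
    have h2 : ((‖a‖₊ - ‖a‖₊ / 2 : NNReal) : ℝ) = ‖a‖ / 2 := by
      rw [NNReal.coe_sub (by simp)]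
      simp
      ring
    rw [← NNReal.coe_sub (by simp), h2]
    apply le_of_eq
    field_simp
  have hmem : ∀ w ∈ ball (P u₀) (‖a‖ * r / 2), Φ.symm w ∈ ball u₀ r := fun w hw =>
    hsrc ▸ Φ.map_target (htgt hw)
  have hinv : ∀ w ∈ ball (P u₀) (‖a‖ * r / 2), P (Φ.symm w) = w := fun w hw =>
    Φ.right_inv (htgt hw)
  refine ⟨Φ.symm, fun w hw => ?_, fun w hw => ⟨hmem w hw, hinv w hw, fun w' hw' => ?_⟩⟩
  · have h1 := (hP.differentiableAt (isOpen_ball.mem_nhds (hmem w hw))).hasDerivAt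
    have h2 : deriv P (Φ.symm w) ≠ 0 := by
      intro h0
      have := hder _ (hmem w hw)
      rw [h0, zero_sub, norm_neg] at this
      linarith
    exact (Φ.hasDerivAt_symm (htgt hw) h2 h1).differentiableAt.differentiableWithinAt
  · have := happ _ (hmem w hw) _ (hmem w' hw')
    rwa [hinv w hw, hinv w' hw'] at this

/-! ### Growth of an entire function near a weighted maximum -/

open Complex Metric Set Filter in
/-- For a nonconstant entire function `g` vanishing at `0`, the quantity
`‖g z‖ * (log (R / ‖z‖)) ^ n` attains its maximum over the punctured disc of radius `R` at a point
whose modulus is comparable to `R`. -/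
theorem exists_max_weighted_norm {g : ℂ → ℂ} (hg : Differentiable ℂ g) (hg0 : g 0 = 0)
    (hnc : ∃ z, g z ≠ 0) {n : ℕ} (hn : 1 ≤ n) :
    ∃ κ > 0, ∀ᶠ R : ℝ in atTop, ∃ z : ℂ, κ * R ≤ ‖z‖ ∧ ‖z‖ < R ∧ κ * R ≤ ‖g z‖ ∧
      1 ≤ ‖g z‖ * Real.log (R / ‖z‖) ∧
      ∀ y : ℂ, y ≠ 0 → ‖y‖ ≤ R →
        ‖g y‖ * Real.log (R / ‖y‖) ^ n ≤ ‖g z‖ * Real.log (R / ‖z‖) ^ n := by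
  set q := dslope g 0 with hq
  have hgq : ∀ z, g z = z * q z := by
    intro z
    have := sub_smul_dslope g 0 z
    simp only [sub_zero, hg0, smul_eq_mul] at this
    exact this.symm
  have hqd : Differentiable ℂ q := by
    rw [← differentiableOn_univ]
    exact (differentiableOn_dslope univ_mem).2 hg.differentiableOn
  obtain ⟨z₁, hz₁⟩ := hnc
  have hqz₁ : 0 < ‖q z₁‖ := by
    rw [norm_pos_iff]
    intro h
    exact hz₁ (by rw [hgq, h, mul_zero])
  -- At |y| = R'e^(-s) with s ≥ S, the weight (1 + s)^n cannot compensate for the factor e^(-s) in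
  -- |y|. Such points therefore never beat the circle |y| = R', and the maximum may be sought on a
  -- compact annulus.
  obtain ⟨S, hS0, hS⟩ : ∃ S : ℝ, 0 ≤ S ∧ ∀ s ≥ S, (1 + s) ^ n ≤ Real.exp s := by
    have h1 : Tendsto (fun s : ℝ => Real.exp (1 + s) / (1 + s) ^ n) atTop atTop :=
      (Real.tendsto_exp_div_pow_atTop n).comp (tendsto_atTop_add_const_left _ 1 tendsto_id)
    obtain ⟨S, hS⟩ := ((h1.eventually_ge_atTop (Real.exp 1)).and
      (eventually_ge_atTop 0)).exists_forall_of_atTop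
    refine ⟨max S 0, le_max_right _ _, fun s hs => ?_⟩
    obtain ⟨h2, h3⟩ := hS s ((le_max_left _ _).trans hs)
    have hp : 0 < (1 + s) ^ n := by positivity
    rw [le_div_iff₀ hp, Real.exp_add] at h2
    exact le_of_mul_le_mul_left h2 (Real.exp_pos 1)
  -- The first entry will bound |g z| from below, the second |z|; neither depends on R.
  set κ := min (‖q z₁‖ / (Real.exp 1 * (S + 1) ^ n)) (Real.exp (-(S + 1))) with hκ
  have hκ0 : 0 < κ := lt_min (by positivity) (by positivity)
  refine ⟨κ, hκ0, ?_⟩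
  filter_upwards [eventually_ge_atTop (Real.exp 1 * ‖z₁‖),
    eventually_ge_atTop (Real.exp 1 / ‖q z₁‖), eventually_ge_atTop (1 / κ),
    eventually_gt_atTop 0] with R hR1 hR2 hR3 hR0
  -- On the circle of radius R' the weight log(R/|y|)^n equals 1.
  set R' := R / Real.exp 1 with hR'
  have he : 0 < Real.exp 1 := Real.exp_pos 1
  have hR'0 : 0 < R' := by positivity
  have hRR' : R = R' * Real.exp 1 := by rw [hR']; field_simp
  have hz₁R : ‖z₁‖ ≤ R' := by rw [hR', le_div_iff₀ he]; linarith
  obtain ⟨z', hz', hmax⟩ := exists_mem_frontier_isMaxOn_norm (f := q) (U := ball 0 R')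
    isBounded_ball ⟨0, mem_ball_self hR'0⟩ hqd.diffContOnCl
  rw [frontier_ball _ hR'0.ne', mem_sphere_zero_iff_norm] at hz'
  rw [closure_ball _ hR'0.ne'] at hmax
  have hqmax : ∀ y, ‖y‖ ≤ R' → ‖q y‖ ≤ ‖q z'‖ := fun y hy =>
    hmax (mem_closedBall_zero_iff.2 hy)
  have hlogR : ∀ y : ℂ, y ≠ 0 → Real.log (R / ‖y‖) = 1 + Real.log (R' / ‖y‖) := by
    intro y hy
    have : ‖y‖ ≠ 0 := norm_ne_zero_iff.2 hy
    rw [hRR', Real.log_div (by positivity) this, Real.log_mul hR'0.ne' he.ne', Real.log_exp,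
      Real.log_div hR'0.ne' this]
    ring
  set v : ℂ → ℝ := fun y => ‖g y‖ * Real.log (R / ‖y‖) ^ n with hv
  set A : Set ℂ := {y | R' * Real.exp (-S) ≤ ‖y‖ ∧ ‖y‖ ≤ R} with hA
  have hApos : ∀ y ∈ A, 0 < ‖y‖ := fun y hy => lt_of_lt_of_le (by positivity) hy.1
  have hAc : IsCompact A := by
    refine (isCompact_closedBall (0 : ℂ) R).of_isClosed_subset ?_ ?_
    · exact (isClosed_le continuous_const continuous_norm).inter
        (isClosed_le continuous_norm continuous_const)
    · intro y hy
      exact mem_closedBall_zero_iff.2 hy.2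
  have hvc : ContinuousOn v A := by
    have hgc := hg.continuous
    refine hgc.norm.continuousOn.mul (ContinuousOn.pow (ContinuousOn.log ?_ ?_) n)
    · exact continuousOn_const.div continuous_norm.continuousOn fun y hy => (hApos y hy).ne'
    · intro y hy
      exact (div_pos hR0 (hApos y hy)).ne'
  have hz'A : z' ∈ A := by
    constructor
    · rw [hz']
      exact mul_le_of_le_one_right hR'0.le (Real.exp_le_one_iff.2 (by linarith))
    · rw [hz', hRR']
      exact le_mul_of_one_le_right hR'0.le (Real.one_le_exp (by norm_num))
  obtain ⟨z, hzA, hzmax⟩ := hAc.exists_isMaxOn ⟨z', hz'A⟩ hvc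
  have hz'0 : z' ≠ 0 := norm_pos_iff.1 (hApos z' hz'A)
  have hvz' : v z' = R' * ‖q z'‖ := by
    simp only [hv]
    rw [hlogR z' hz'0, hz', div_self hR'0.ne', hgq, norm_mul, hz']
    simp
  have hvz : R' * ‖q z'‖ ≤ v z := hvz' ▸ hzmax hz'A
  have hzpos := hApos z hzA
  set ℓ := Real.log (R / ‖z‖) with hℓ
  have hℓ0 : 0 ≤ ℓ := Real.log_nonneg ((one_le_div hzpos).2 hzA.2)
  have hℓS : ℓ ≤ S + 1 := by
    rw [hℓ, Real.log_le_iff_le_exp (by positivity), div_le_iff₀ hzpos, hRR']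
    calc R' * Real.exp 1 = Real.exp (S + 1) * (R' * Real.exp (-S)) := by
          rw [Real.exp_add, Real.exp_neg]; field_simp
      _ ≤ _ := by gcongr; exact hzA.1
  have hM : R' * ‖q z₁‖ ≤ R' * ‖q z'‖ := by gcongr; exact hqmax _ hz₁R
  have hTl : R' * ‖q z₁‖ ≤ ‖g z‖ * ℓ ^ n := hM.trans hvz
  have hM1 : 1 ≤ R' * ‖q z₁‖ := by
    rw [hR', div_mul_eq_mul_div, one_le_div he]
    rwa [div_le_iff₀ hqz₁] at hR2
  have hTκ : κ * R ≤ ‖g z‖ := by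
    have h1 : R' * ‖q z₁‖ ≤ ‖g z‖ * (S + 1) ^ n :=
      hTl.trans (by gcongr)
    calc κ * R ≤ ‖q z₁‖ / (Real.exp 1 * (S + 1) ^ n) * R := by gcongr; exact min_le_left _ _
      _ = R' * ‖q z₁‖ / (S + 1) ^ n := by rw [hR']; field_simp
      _ ≤ ‖g z‖ := by rwa [div_le_iff₀ (by positivity)]
  have hT1 : 1 ≤ ‖g z‖ := by
    refine le_trans ?_ hTκ
    rwa [div_le_iff₀ hκ0, mul_comm] at hR3
  have hℓ0' : 0 < ℓ := by
    refine lt_of_le_of_ne hℓ0 fun h => ?_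
    rw [← h, zero_pow (by omega), mul_zero] at hTl
    linarith
  refine ⟨z, ?_, ?_, hTκ, ?_, ?_⟩
  · calc κ * R ≤ Real.exp (-(S + 1)) * R := by gcongr; exact min_le_right _ _
      _ = R' * Real.exp (-S) := by rw [hRR', neg_add, Real.exp_add, Real.exp_neg 1]; field_simp
      _ ≤ ‖z‖ := hzA.1
  · refine lt_of_le_of_ne hzA.2 fun h => ?_
    rw [hℓ, h, div_self hR0.ne', Real.log_one] at hℓ0'
    exact lt_irrefl _ hℓ0'
  · rcases le_total ℓ 1 with h | h
    · refine (hM1.trans hTl).trans ?_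
      gcongr
      exact pow_le_of_le_one hℓ0 h (by omega)
    · nlinarith
  · intro y hy hyR
    by_cases hyA : R' * Real.exp (-S) ≤ ‖y‖
    · exact hzmax ⟨hyA, hyR⟩
    · push Not at hyA
      have hypos : 0 < ‖y‖ := norm_pos_iff.2 hy
      refine le_trans ?_ hvz
      rw [hlogR y hy]
      set s := Real.log (R' / ‖y‖) with hs
      have hsS : S ≤ s := by
        rw [hs, Real.le_log_iff_exp_le (by positivity), le_div_iff₀ hypos]
        calc Real.exp S * ‖y‖ ≤ Real.exp S * (R' * Real.exp (-S)) := by gcongr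
          _ = R' := by rw [Real.exp_neg]; field_simp
      have hyR' : ‖y‖ ≤ R' := hyA.le.trans
        (mul_le_of_le_one_right hR'0.le (Real.exp_le_one_iff.2 (by linarith)))
      have hes : Real.exp s = R' / ‖y‖ := Real.exp_log (by positivity)
      calc ‖g y‖ * (1 + s) ^ n ≤ (‖y‖ * ‖q z'‖) * (R' / ‖y‖) := by
            rw [hgq, norm_mul]
            have := hS s hsS
            rw [hes] at this
            have h0 : 0 ≤ 1 + s := by linarith
            gcongr
            exact hqmax y hyR'
        _ = R' * ‖q z'‖ := by field_simp

open Complex in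
/-- At a maximum point of the weighted norm, `g` grows at most like an exponential in a
logarithmic coordinate. -/
theorem norm_le_exp_of_weighted_max {g : ℂ → ℂ} {n : ℕ} {R : ℝ} {z : ℂ} (hz : z ≠ 0)
    (hzR : ‖z‖ < R)
    (hmax : ∀ y : ℂ, y ≠ 0 → ‖y‖ ≤ R →
        ‖g y‖ * Real.log (R / ‖y‖) ^ n ≤ ‖g z‖ * Real.log (R / ‖z‖) ^ n)
    {u : ℂ} (hu : u.re < n) (hn : 0 < n) :
    ‖g (z * exp (u * (Real.log (R / ‖z‖) / n : ℝ)))‖ ≤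
      ‖g z‖ * Real.exp (u.re + u.re ^ 2 / (n - u.re)) := by
  set ℓ := Real.log (R / ‖z‖) with hℓ
  have hz0 : 0 < ‖z‖ := norm_pos_iff.2 hz
  have hR0 : 0 < R := hz0.trans hzR
  have hℓ0 : 0 < ℓ := Real.log_pos ((one_lt_div hz0).2 hzR)
  have hn' : (0 : ℝ) < n := by exact_mod_cast hn
  set x := u.re with hx
  set y := z * exp (u * (ℓ / n : ℝ)) with hy
  have hyn : ‖y‖ = ‖z‖ * Real.exp (x * (ℓ / n)) := by
    rw [hy, norm_mul, norm_exp, re_mul_ofReal]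
  -- The scaling of u by ℓ/n turns the weight into ℓ^n (1 - x/n)^n, whose last factor is
  -- approximately e^(-x).
  have hlog : Real.log (R / ‖y‖) = ℓ * (1 - x / n) := by
    rw [hyn, ← div_div, Real.log_div (by positivity) (by positivity), Real.log_exp, ← hℓ]
    ring
  have h1 : 0 < 1 - x / n := by rw [sub_pos, div_lt_one hn']; exact hu
  have hyR : ‖y‖ ≤ R := by
    have h3 : (0 : ℝ) < ‖y‖ := by rw [hyn]; positivity
    have h2 : 0 < Real.log (R / ‖y‖) := by rw [hlog]; positivity
    have := (Real.log_pos_iff (by positivity)).1 h2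
    exact ((one_lt_div h3).1 this).le
  have h2 := hmax y (by rw [hy]; exact mul_ne_zero hz (exp_ne_zero _)) hyR
  rw [hlog, mul_pow, mul_comm (ℓ ^ n), ← mul_assoc] at h2
  have h3 : ‖g y‖ * (1 - x / n) ^ n ≤ ‖g z‖ := le_of_mul_le_mul_right h2 (by positivity)
  -- This is 1 + t ≤ e^t at t = (x/n)/(1 - x/n), where 1 + t = 1/(1 - x/n); its n-th power has
  -- exponent nt = x + x²/(n - x).
  have h4 : 1 ≤ (1 - x / n) * Real.exp (x / n / (1 - x / n)) := by
    have := Real.add_one_le_exp (x / n / (1 - x / n))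
    calc 1 = (1 - x / n) * (x / n / (1 - x / n) + 1) := by
          rw [mul_add, mul_div_cancel₀ _ h1.ne']; ring
      _ ≤ _ := by gcongr
  have h5 : 1 ≤ (1 - x / n) ^ n * Real.exp (x + x ^ 2 / (n - x)) := by
    have h6 := one_le_pow₀ h4 (n := n)
    rw [mul_pow, ← Real.exp_nat_mul] at h6
    have h7 : (n : ℝ) - x ≠ 0 := by linarith
    have h8 : x + x ^ 2 / (n - x) = n * (x / n / (1 - x / n)) := by
      rw [one_sub_div hn'.ne']
      field_simp
      ring
    rwa [h8]
  calc ‖g y‖ ≤ ‖g y‖ * ((1 - x / n) ^ n * Real.exp (x + x ^ 2 / (n - x))) :=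
        le_mul_of_one_le_right (norm_nonneg _) h5
    _ = ‖g y‖ * (1 - x / n) ^ n * Real.exp (x + x ^ 2 / (n - x)) := by ring
    _ ≤ _ := by gcongr

/-! ### Inverse branches on large discs -/

open Complex Metric Set in
/-- A holomorphic function on a disc which is `1` at the centre and has modulus at most `1 + η` is
close to `1` on the disc of half the radius. -/
theorem norm_sub_one_le_of_norm_le {Q : ℂ → ℂ} {η r : ℝ} (hη : 0 < η) (hr : 0 < r)
    (hQ : DifferentiableOn ℂ Q (ball 0 (2 * r))) (hQ0 : Q 0 = 1)
    (hb : ∀ u ∈ ball (0 : ℂ) (2 * r), ‖Q u‖ ≤ 1 + η) {u : ℂ} (hu : ‖u‖ ≤ r) :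
    ‖Q u - 1‖ ≤ 2 * η := by
  have h1 : MapsTo (fun u => Q u - 1) (ball 0 (2 * r)) {z | z.re ≤ η} := by
    intro v hv
    have h2 := (re_le_norm (Q v)).trans (hb v hv)
    change (Q v - 1).re ≤ η
    rw [sub_re, one_re]
    linarith
  have h2 := borelCaratheodory_zero hη (hQ.sub_const 1) h1 (by positivity)
    (mem_ball_zero_iff.2 (by linarith : ‖u‖ < 2 * r)) (by simp [hQ0])
  refine h2.trans ?_
  rw [div_le_iff₀ (by linarith)]
  nlinarith

open Complex Metric Set in
/-- A function growing at most like an exponential near `0` has a holomorphic inverse branch on a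
large disc centred on the positive imaginary axis. -/
theorem exists_inverse_of_norm_le_exp {P : ℂ → ℂ} (hP : Differentiable ℂ P) (h0 : P 0 ≠ 0)
    (hb : ∀ u ∈ ball (0 : ℂ) (2 * 8), ‖P u‖ ≤ ‖P 0‖ * Real.exp u.re * (1 + 1 / 1000)) :
    ∃ ψ : ℂ → ℂ, DifferentiableOn ℂ ψ (ball (‖P 0‖ * I) (‖P 0‖ / 40)) ∧
      ∀ w ∈ ball (‖P 0‖ * I) (‖P 0‖ / 40), ‖ψ w‖ ≤ 4 ∧ P (ψ w) = w ∧
        ∀ w' ∈ ball (‖P 0‖ * I) (‖P 0‖ / 40),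
          ‖w - w' - ‖P 0‖ * I * (ψ w - ψ w')‖ ≤ ‖P 0‖ / 2 * ‖ψ w - ψ w'‖ := by
  set T := ‖P 0‖ with hT
  have hT0 : 0 < T := norm_pos_iff.2 h0
  set Q : ℂ → ℂ := fun u => P u * exp (-u) / P 0 with hQ
  have hQd : Differentiable ℂ Q := by fun_prop
  have hPQ : ∀ u, P u = P 0 * exp u * Q u := by
    intro u
    simp only [hQ, exp_neg]
    field_simp [exp_ne_zero]
  have hQb : ∀ u ∈ ball (0 : ℂ) (2 * 8), ‖Q u‖ ≤ 1 + 1 / 1000 := by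
    intro u hu
    have := hb u hu
    rw [hPQ u, norm_mul, norm_mul, norm_exp, ← hT] at this
    exact le_of_mul_le_mul_left this (by positivity)
  have hQ1 : ∀ u : ℂ, ‖u‖ ≤ 8 → ‖Q u - 1‖ ≤ 1 / 500 := by
    intro u hu
    have := norm_sub_one_le_of_norm_le (by norm_num) (by norm_num) hQd.differentiableOn
      (by simp [hQ, h0]) hQb hu
    linarith
  have hQ' : ∀ u : ℂ, ‖u‖ ≤ 7 → ‖deriv Q u‖ ≤ 1 / 500 := by
    intro u hu
    have h1 := norm_deriv_le_of_forall_mem_sphere_norm_le (c := u) (R := 1) (C := 1 / 500)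
      (f := fun u => Q u - 1) one_pos (hQd.sub_const 1).diffContOnCl fun z hz => by
        refine hQ1 z ?_
        rw [mem_sphere_iff_norm] at hz
        calc ‖z‖ = ‖(z - u) + u‖ := by ring_nf
          _ ≤ ‖z - u‖ + ‖u‖ := norm_add_le _ _
          _ ≤ 8 := by linarith
    rw [deriv_sub_const] at h1
    linarith
  -- Since |P 0| = T already, only the argument needs turning, so u₀ is purely imaginary of modulus
  -- at most π.
  obtain ⟨u₀, hu₀, hexp⟩ : ∃ u₀ : ℂ, ‖u₀‖ ≤ 3.15 ∧ P 0 * exp u₀ = T * I := by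
    refine ⟨(arg (I / P 0) : ℂ) * I, ?_, ?_⟩
    · rw [norm_mul, norm_I, mul_one, norm_real, Real.norm_eq_abs]
      exact (abs_arg_le_pi _).trans Real.pi_lt_d2.le
    · have h1 := norm_mul_exp_arg_mul_I (I / P 0)
      rw [norm_div, norm_I, ← hT] at h1
      have hTc : (T : ℂ) ≠ 0 := by exact_mod_cast hT0.ne'
      have h2 : exp (arg (I / P 0) * I) = T * (I / P 0) := by
        calc exp (arg (I / P 0) * I) = T * ((1 / T : ℝ) * exp (arg (I / P 0) * I)) := by
              push_cast
              field_simp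
          _ = _ := by rw [h1]
      rw [h2]
      field_simp
  set a : ℂ := T * I with ha
  have han : ‖a‖ = T := by rw [ha, norm_mul, norm_I, norm_real, mul_one, Real.norm_of_nonneg hT0.le]
  have ha0 : a ≠ 0 := norm_pos_iff.1 (han ▸ hT0)
  have hder : ∀ u ∈ ball u₀ (1 / 10), ‖deriv P u - a‖ ≤ ‖a‖ / 2 := by
    intro u hu
    rw [mem_ball_iff_norm] at hu
    have hun : ‖u‖ ≤ 7 := by
      calc ‖u‖ = ‖(u - u₀) + u₀‖ := by ring_nf
        _ ≤ ‖u - u₀‖ + ‖u₀‖ := norm_add_le _ _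
        _ ≤ 7 := by norm_num at hu hu₀ ⊢; linarith
    have h1 : HasDerivAt P (P 0 * exp u * Q u + P 0 * exp u * deriv Q u) u := by
      exact (((hasDerivAt_exp u).const_mul _).mul (hQd u).hasDerivAt).congr_of_eventuallyEq
        (Filter.Eventually.of_forall hPQ)
    have h2 : P 0 * exp u = a * exp (u - u₀) := by
      rw [← hexp, exp_sub]
      field_simp [exp_ne_zero]
    have h3 : ‖exp (u - u₀) - 1‖ ≤ 0.11 := by
      have h4 := norm_exp_sub_one_sub_id_le (hu.le.trans (by norm_num))
      calc ‖exp (u - u₀) - 1‖ = ‖(exp (u - u₀) - 1 - (u - u₀)) + (u - u₀)‖ := by ring_nf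
        _ ≤ ‖exp (u - u₀) - 1 - (u - u₀)‖ + ‖u - u₀‖ := norm_add_le _ _
        _ ≤ ‖u - u₀‖ ^ 2 + ‖u - u₀‖ := by linarith
        _ ≤ 0.11 := by
          have := norm_nonneg (u - u₀)
          norm_num
          nlinarith
    rw [h1.deriv, h2]
    set e := exp (u - u₀) - 1 with he
    have h5 : a * exp (u - u₀) * Q u + a * exp (u - u₀) * deriv Q u - a =
        a * (e + (1 + e) * ((Q u - 1) + deriv Q u)) := by rw [he]; ring
    rw [h5, norm_mul]
    have h6 : ‖e + (1 + e) * ((Q u - 1) + deriv Q u)‖ ≤ 1 / 2 := by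
      have h7 : ‖1 + e‖ ≤ 1 + 0.11 := (norm_add_le _ _).trans (by rw [norm_one]; linarith)
      have h8 : ‖(Q u - 1) + deriv Q u‖ ≤ 1 / 500 + 1 / 500 :=
        (norm_add_le _ _).trans (add_le_add (hQ1 u (by linarith)) (hQ' u hun))
      calc _ ≤ ‖e‖ + ‖1 + e‖ * ‖(Q u - 1) + deriv Q u‖ := by
            rw [← norm_mul]; exact norm_add_le _ _
        _ ≤ 0.11 + (1 + 0.11) * (1 / 500 + 1 / 500) := by gcongr
        _ ≤ 1 / 2 := by norm_num
    calc _ ≤ ‖a‖ * (1 / 2) := by gcongr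
      _ = _ := by ring
  obtain ⟨ψ, hψd, hψ⟩ := exists_holomorphic_inverse ha0 hP.differentiableOn hder
  -- The inverse lives on radius T/20 about P u₀, which is within T/500 of a.
  have hsub : ball a (T / 40) ⊆ ball (P u₀) (‖a‖ * (1 / 10) / 2) := by
    refine ball_subset_ball' ?_
    have h1 : a - P u₀ = a * -(Q u₀ - 1) := by rw [hPQ u₀, hexp]; ring
    rw [dist_eq_norm, h1, norm_mul, norm_neg, han]
    have := hQ1 u₀ (hu₀.trans (by norm_num))
    nlinarith
  refine ⟨ψ, hψd.mono hsub, fun w hw => ?_⟩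
  obtain ⟨h1, h2, h3⟩ := hψ w (hsub hw)
  refine ⟨?_, h2, fun w' hw' => ?_⟩
  · rw [mem_ball_iff_norm] at h1
    calc ‖ψ w‖ = ‖(ψ w - u₀) + u₀‖ := by ring_nf
      _ ≤ ‖ψ w - u₀‖ + ‖u₀‖ := norm_add_le _ _
      _ ≤ 4 := by norm_num at h1 hu₀ ⊢; linarith
  · have := h3 w' (hsub hw')
    rwa [han] at this

open Complex Metric Set Filter in
/-- A nonconstant entire function vanishing at `0` has inverse branches on arbitrarily large discs
`ball (T * I) (T / 40)`, with polynomial control of the branch in terms of `T`. -/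
theorem exists_large_inverse_branch {g : ℂ → ℂ} (hg : Differentiable ℂ g) (hg0 : g 0 = 0)
    (hnc : ∃ z, g z ≠ 0) (B : ℝ) :
    ∃ T ≥ B, ∃ φ : ℂ → ℂ, DifferentiableOn ℂ φ (ball (T * I) (T / 40)) ∧
      (∀ w ∈ ball (T * I) (T / 40), g (φ w) = w ∧ ‖φ w‖ ≤ T ^ 2) ∧
      1 / T ^ 2 ≤ ‖φ (T * I + Real.pi * I) - φ (T * I)‖ := by
  -- For |Re u| ≤ 16 this makes the error exponent (Re u)²/(n - Re u) at most 1/2000.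
  obtain ⟨n, hn⟩ : ∃ n : ℕ, (10 : ℝ) ^ 6 ≤ n := exists_nat_ge _
  have hn0 : (0 : ℝ) < n := lt_of_lt_of_le (by norm_num) hn
  have hn1 : 1 ≤ n := Nat.one_le_iff_ne_zero.2 (by rintro rfl; simp at hn0)
  obtain ⟨κ, hκ, hev⟩ := exists_max_weighted_norm hg hg0 hnc hn1
  -- As κR ≤ T, the bound 1/κ yields R ≤ T², and 8 log(1/κ) yields 8ℓ ≤ T. The later condition R ≥
  -- n/κ² absorbs the constants in the lower bound for the gap.
  have hev2 : ∀ᶠ R : ℝ in atTop, max (max B 1000) (max (1 / κ) (8 * Real.log (1 / κ))) ≤ κ * R :=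
    (tendsto_id.const_mul_atTop hκ).eventually_ge_atTop _
  obtain ⟨R, ⟨z, hz1, hz2, hz3, hz4, hmax⟩, hR1, hR2, hR3⟩ :=
    (hev.and (hev2.and ((eventually_gt_atTop 0).and
      (eventually_ge_atTop (n / κ ^ 2))))).exists
  simp only [max_le_iff] at hR1
  obtain ⟨⟨hRB, hR1000⟩, hRκ, hRlog⟩ := hR1
  have hzpos : 0 < ‖z‖ := lt_of_lt_of_le (by positivity) hz1
  have hz0 : z ≠ 0 := norm_pos_iff.1 hzpos
  set ℓ := Real.log (R / ‖z‖) with hℓ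
  have hℓ0 : 0 < ℓ := Real.log_pos ((one_lt_div hzpos).2 hz2)
  have hℓexp : Real.exp ℓ = R / ‖z‖ := Real.exp_log (by positivity)
  have hℓκ : ℓ ≤ Real.log (1 / κ) := by
    refine Real.log_le_log (by positivity) ?_
    rw [div_le_div_iff₀ hzpos hκ]
    linarith
  set P : ℂ → ℂ := fun u => g (z * exp (u * (ℓ / n : ℝ))) with hP
  have hPd : Differentiable ℂ P := by
    refine hg.comp ?_
    fun_prop
  have hP0 : P 0 = g z := by simp [hP]
  set T := ‖P 0‖ with hT
  have hTz : T = ‖g z‖ := by rw [hT, hP0]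
  rw [← hTz] at hz3 hz4
  have hT1000 : 1000 ≤ T := hR1000.trans hz3
  have hT0 : 0 < T := by linarith
  have hb : ∀ u ∈ ball (0 : ℂ) (2 * 8), ‖P u‖ ≤ T * Real.exp u.re * (1 + 1 / 1000) := by
    intro u hu
    rw [mem_ball_zero_iff] at hu
    have hre : |u.re| ≤ 16 := (abs_re_le_norm u).trans (by linarith)
    obtain ⟨hre1, hre2⟩ := abs_le.1 hre
    have h1 := norm_le_exp_of_weighted_max hz0 hz2 hmax (u := u) (by linarith) (by omega)
    rw [Real.exp_add, ← hTz, ← mul_assoc] at h1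
    refine h1.trans ?_
    gcongr
    have h2 : u.re ^ 2 / (n - u.re) ≤ 1 / 2000 := by
      rw [div_le_div_iff₀ (by linarith) (by norm_num)]
      nlinarith
    have h3 : 0 ≤ u.re ^ 2 / (n - u.re) := div_nonneg (sq_nonneg _) (by linarith)
    have h4 := Real.abs_exp_sub_one_le (x := u.re ^ 2 / (n - u.re))
      (by rw [abs_of_nonneg h3]; linarith)
    rw [abs_of_nonneg h3] at h4
    linarith [le_abs_self (Real.exp (u.re ^ 2 / (n - u.re)) - 1)]
  obtain ⟨ψ, hψd, hψ⟩ := exists_inverse_of_norm_le_exp hPd (norm_pos_iff.1 hT0) hb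
  have hmem1 : (T : ℂ) * I ∈ ball ((T : ℂ) * I) (T / 40) := mem_ball_self (by positivity)
  have hmem2 : (T : ℂ) * I + Real.pi * I ∈ ball ((T : ℂ) * I) (T / 40) := by
    rw [mem_ball_iff_norm, add_sub_cancel_left, norm_mul, norm_I, norm_real, mul_one,
      Real.norm_of_nonneg Real.pi_pos.le]
    linarith [Real.pi_lt_four]
  have hexpnorm : ∀ u : ℂ, ‖z * exp (u * (ℓ / n : ℝ))‖ = ‖z‖ * Real.exp (u.re * (ℓ / n)) := by
    intro u
    rw [norm_mul, norm_exp, re_mul_ofReal]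
  have hbd : ∀ u : ℂ, ‖u‖ ≤ 4 → |u.re * (ℓ / n)| ≤ ℓ := by
    intro u hu
    have h1 : |u.re| ≤ n := (abs_re_le_norm u).trans (by linarith)
    rw [abs_mul, abs_of_pos (by positivity : 0 < ℓ / n)]
    calc |u.re| * (ℓ / n) ≤ n * (ℓ / n) := by gcongr
      _ = ℓ := by field_simp
  refine ⟨T, hRB.trans hz3, fun w => z * exp (ψ w * (ℓ / n : ℝ)), ?_, fun w hw => ?_, ?_⟩
  · exact ((hψd.mul_const _).cexp).const_mul z
  · obtain ⟨h1, h2, -⟩ := hψ w hw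
    refine ⟨h2, ?_⟩
    rw [hexpnorm]
    calc ‖z‖ * Real.exp ((ψ w).re * (ℓ / n)) ≤ ‖z‖ * Real.exp ℓ := by
          gcongr; exact (abs_le.1 (hbd _ h1)).2
      _ = R := by rw [hℓexp]; field_simp
      _ = 1 / κ * (κ * R) := by field_simp
      _ ≤ T * T := by gcongr; exact hRκ.trans hz3
      _ = T ^ 2 := by ring
  · obtain ⟨h1, -, h3⟩ := hψ _ hmem2
    obtain ⟨h1', -, -⟩ := hψ _ hmem1
    have h4 := h3 _ hmem1
    set u₁ := ψ (T * I + Real.pi * I)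
    set u₂ := ψ (T * I)
    rw [add_sub_cancel_left] at h4
    have hπn : ‖(Real.pi : ℂ) * I‖ = Real.pi := by
      rw [norm_mul, norm_I, norm_real, mul_one, Real.norm_of_nonneg Real.pi_pos.le]
    have hTn : ‖(T : ℂ) * I * (u₁ - u₂)‖ = T * ‖u₁ - u₂‖ := by
      rw [norm_mul, norm_mul, norm_I, norm_real, mul_one, Real.norm_of_nonneg hT0.le]
    have h5 := norm_sub_norm_le ((Real.pi : ℂ) * I) (T * I * (u₁ - u₂))
    have h6 := norm_sub_norm_le (T * I * (u₁ - u₂)) ((Real.pi : ℂ) * I)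
    rw [norm_sub_rev] at h6
    rw [hπn, hTn] at h5 h6
    -- ψ inverts a map close to multiplication by iT, so a step πi in w moves ψ by about π/T.
    have hd1 : 2 ≤ T * ‖u₁ - u₂‖ := by linarith [Real.pi_gt_three]
    have hd2 : T * ‖u₁ - u₂‖ ≤ 8 := by linarith [Real.pi_lt_four]
    set x : ℂ := (u₁ - u₂) * (ℓ / n : ℝ) with hx
    have hxn : ‖x‖ = ‖u₁ - u₂‖ * (ℓ / n) := by
      rw [hx, norm_mul, norm_real, Real.norm_of_nonneg (by positivity)]
    have hx1 : ‖x‖ ≤ 1 / 2 := by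
      have h7 : ‖u₁ - u₂‖ * ℓ ≤ 1 := by
        have h8 : 8 * ℓ ≤ T := by linarith
        have h9 : ‖u₁ - u₂‖ * (8 * ℓ) ≤ ‖u₁ - u₂‖ * T := by gcongr
        linarith
      rw [hxn, ← mul_div_assoc, div_le_iff₀ hn0]
      linarith
    have hex : ‖x‖ / 2 ≤ ‖exp x - 1‖ := by
      have h7 := norm_exp_sub_one_sub_id_le (hx1.trans (by norm_num))
      have h8 := norm_sub_norm_le x (x - (exp x - 1))
      rw [sub_sub_cancel, norm_sub_rev x] at h8
      nlinarith [norm_nonneg x]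
    have hfac : z * exp (u₁ * (ℓ / n : ℝ)) - z * exp (u₂ * (ℓ / n : ℝ)) =
        z * exp (u₂ * (ℓ / n : ℝ)) * (exp x - 1) := by
      have : u₁ * (ℓ / n : ℝ) = u₂ * (ℓ / n : ℝ) + x := by rw [hx]; ring
      rw [this, exp_add]
      ring
    rw [hfac, norm_mul, hexpnorm]
    have hlow : κ ^ 2 * R ≤ ‖z‖ * Real.exp (u₂.re * (ℓ / n)) := by
      calc κ ^ 2 * R = (κ * R) * (κ * R / R) := by field_simp
        _ ≤ ‖z‖ * (‖z‖ / R) := by gcongr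
        _ = ‖z‖ * Real.exp (-ℓ) := by rw [Real.exp_neg, hℓexp, inv_div]
        _ ≤ _ := by gcongr; exact (abs_le.1 (hbd _ h1')).1
    have hxlow : 1 / (n * T ^ 2) ≤ ‖x‖ / 2 := by
      rw [hxn, div_le_iff₀ (by positivity)]
      calc (1 : ℝ) ≤ (T * ‖u₁ - u₂‖ / 2) * (T * ℓ) := by nlinarith
        _ = _ := by field_simp
    calc 1 / T ^ 2 = n * (1 / (n * T ^ 2)) := by field_simp
      _ ≤ κ ^ 2 * R * (1 / (n * T ^ 2)) := by
          gcongr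
          rw [div_le_iff₀ (by positivity)] at hR3
          linarith
      _ ≤ _ := by gcongr; exact hxlow.trans hex

/-! ### The difference equations -/

open Complex Metric Set in
/-- If `φ` is an inverse branch on a large disc `ball (T * I) (T / 40)` with moderate bounds, then
`φ (X + π I) - φ X` is `C * exp (h X)` with `h` mapping a disc into a much smaller one. -/
theorem exists_log_difference {g φ : ℂ → ℂ} {T : ℝ} {C : ℂ} (hC : C ≠ 0)
    (hT : 100 + 10 * Real.log T + |Real.log ‖C‖| ≤ T / 1000) (hT1 : 1 ≤ T)
    (hφ : DifferentiableOn ℂ φ (ball (T * I) (T / 40)))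
    (hg : ∀ w ∈ ball ((T : ℂ) * I) (T / 40), g (φ w) = w ∧ ‖φ w‖ ≤ T ^ 2)
    (hlow : 1 / T ^ 2 ≤ ‖φ (T * I + Real.pi * I) - φ (T * I)‖) :
    ∃ h : ℂ → ℂ, DifferentiableOn ℂ h (ball (T * I) (T / 100)) ∧
      MapsTo h (ball (T * I) (T / 100)) (closedBall (T * I) (T / 100 / 8)) ∧
      ∀ X ∈ ball ((T : ℂ) * I) (T / 100), φ (X + Real.pi * I) - φ X = C * exp (h X) := by
  have hlogT : 0 ≤ Real.log T := Real.log_nonneg hT1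
  have hT0 : 100000 ≤ T := by linarith [abs_nonneg (Real.log ‖C‖)]
  set c : ℂ := T * I with hc
  have hπn : ‖(Real.pi : ℂ) * I‖ = Real.pi := by
    rw [norm_mul, norm_I, norm_real, mul_one, Real.norm_of_nonneg Real.pi_pos.le]
  have hsub : ball c (T / 50) ⊆ ball c (T / 40) := ball_subset_ball (by linarith)
  have hshift : MapsTo (fun X => X + Real.pi * I) (ball c (T / 50)) (ball c (T / 40)) := by
    intro X hX
    rw [mem_ball_iff_norm] at *
    calc ‖X + Real.pi * I - c‖ = ‖(X - c) + Real.pi * I‖ := by ring_nf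
      _ ≤ ‖X - c‖ + Real.pi := (norm_add_le _ _).trans (by rw [hπn])
      _ < _ := by linarith [Real.pi_lt_four]
  set k : ℂ → ℂ := fun X => (φ (X + Real.pi * I) - φ X) / C with hk
  have hkd : DifferentiableOn ℂ k (ball c (T / 50)) := by
    refine ((hφ.comp (by fun_prop) hshift).sub (hφ.mono hsub)).div_const C
  have hk0 : ∀ X ∈ ball c (T / 50), k X ≠ 0 := by
    intro X hX h0
    rcases div_eq_zero_iff.1 h0 with h1 | h1
    · have h2 := congrArg g (sub_eq_zero.1 h1)
      rw [(hg _ (hshift hX)).1, (hg _ (hsub hX)).1] at h2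
      simp at h2
    · exact hC h1
  obtain ⟨h, hhd, hh⟩ := exists_exp_eq_on_ball (by linarith) hkd hk0
  have hCn : 0 < ‖C‖ := norm_pos_iff.2 hC
  have hre : ∀ X ∈ ball c (T / 50), (h X).re = Real.log ‖φ (X + Real.pi * I) - φ X‖
      - Real.log ‖C‖ := by
    intro X hX
    have h1 := congrArg (fun z => Real.log ‖z‖) (hh X hX)
    have h2 : ‖φ (X + Real.pi * I) - φ X‖ ≠ 0 := by
      have := hk0 X hX
      intro h0
      apply this
      simp only [hk]
      rw [norm_eq_zero.1 h0, zero_div]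
    simp only [norm_exp, Real.log_exp, hk, norm_div] at h1
    rw [h1, Real.log_div h2 hCn.ne']
  have hup : ∀ X ∈ ball c (T / 50),
      (h X).re ≤ 1 + 2 * Real.log T - Real.log ‖C‖ := by
    intro X hX
    rw [hre X hX]
    have h1 : ‖φ (X + Real.pi * I) - φ X‖ ≤ Real.exp 1 * T ^ 2 := by
      have h2 := (hg _ (hshift hX)).2
      have h3 := (hg _ (hsub hX)).2
      have h4 := Real.add_one_le_exp (1 : ℝ)
      have h5 := norm_sub_le (φ (X + Real.pi * I)) (φ X)
      nlinarith [sq_nonneg T]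
    have h2 : Real.log ‖φ (X + Real.pi * I) - φ X‖ ≤ 1 + 2 * Real.log T := by
      rcases (norm_nonneg (φ (X + Real.pi * I) - φ X)).eq_or_lt with h0 | h0
      · rw [← h0, Real.log_zero]; linarith
      · refine (Real.log_le_log h0 h1).trans ?_
        rw [Real.log_mul (Real.exp_pos 1).ne' (by positivity), Real.log_exp, Real.log_pow]
        norm_num
    linarith
  have hcm : c ∈ ball c (T / 50) := mem_ball_self (by linarith)
  have hlo : -(2 * Real.log T) - Real.log ‖C‖ ≤ (h c).re := by
    rw [hre c hcm]
    have := Real.log_le_log (by positivity) hlow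
    rw [one_div, Real.log_inv, Real.log_pow] at this
    push_cast at this
    linarith
  set A : ℝ := 1 + 4 * Real.log T with hA
  -- The real part of h - h(c) is at most A on radius T/50, so Borel–Carathéodory bounds its modulus
  -- by 2A on half that radius.
  have hosc : ∀ X ∈ ball c (T / 100), ‖h X - h c‖ ≤ 2 * A := by
    intro X hX
    rw [mem_ball_iff_norm] at hX
    have hin : MapsTo (fun z => c + z) (ball 0 (T / 50)) (ball c (T / 50)) := by
      intro z hz
      simpa [mem_ball_iff_norm] using hz
    have h1 : DifferentiableOn ℂ (fun z => h (c + z) - h c) (ball 0 (T / 50)) :=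
      (hhd.comp (by fun_prop) hin).sub_const _
    have h2 : MapsTo (fun z => h (c + z) - h c) (ball 0 (T / 50)) {z | z.re ≤ A} := by
      intro z hz
      have := hup _ (hin hz)
      change (h (c + z) - h c).re ≤ A
      rw [sub_re]
      linarith
    have h3 := borelCaratheodory_zero (by linarith) h1 h2 (by linarith)
      (mem_ball_zero_iff.2 (by linarith : ‖X - c‖ < T / 50)) (by simp)
    simp only [add_sub_cancel] at h3
    refine h3.trans ?_
    rw [div_le_iff₀ (by linarith)]
    have hA0 : 0 ≤ A := by linarith
    nlinarith
  -- Re h(c) is already O(log T), while Im h(c) is free modulo 2π. This is why the discs are centred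
  -- at iT: a multiple of 2πi brings h(c) close to c.
  obtain ⟨m, hm⟩ : ∃ m : ℤ, |(h c).im + m * (2 * Real.pi) - T| ≤ Real.pi := by
    have hπ := Real.pi_pos
    refine ⟨round ((T - (h c).im) / (2 * Real.pi)), ?_⟩
    have h1 := abs_sub_round ((T - (h c).im) / (2 * Real.pi))
    set r : ℝ := (round ((T - (h c).im) / (2 * Real.pi)) : ℝ)
    have h2 : (h c).im + r * (2 * Real.pi) - T =
        -(((T - (h c).im) / (2 * Real.pi) - r) * (2 * Real.pi)) := by
      field_simp
      ring
    rw [h2, abs_neg, abs_mul, abs_of_pos (by positivity : 0 < 2 * Real.pi)]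
    nlinarith
  refine ⟨fun X => h X + m * (2 * Real.pi * I), ?_, fun X hX => ?_, fun X hX => ?_⟩
  · exact (hhd.mono (ball_subset_ball (by linarith))).add_const _
  · rw [mem_closedBall_iff_norm]
    have h1 := hosc X hX
    have h2 : ‖h c + m * (2 * Real.pi * I) - c‖ ≤ 1 + 2 * Real.log T + |Real.log ‖C‖| + 4 := by
      refine (norm_le_abs_re_add_abs_im _).trans ?_
      have h3 : (h c + m * (2 * Real.pi * I) - c).re = (h c).re := by simp [hc]
      have h4 : (h c + m * (2 * Real.pi * I) - c).im = (h c).im + m * (2 * Real.pi) - T := by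
        simp [hc]
      rw [h3, h4]
      have h5 : |(h c).re| ≤ 1 + 2 * Real.log T + |Real.log ‖C‖| := by
        have := hup c hcm
        rw [abs_le]
        constructor <;> linarith [le_abs_self (Real.log ‖C‖), neg_abs_le (Real.log ‖C‖)]
      linarith [Real.pi_lt_four]
    calc ‖h X + m * (2 * Real.pi * I) - c‖
        = ‖(h X - h c) + (h c + m * (2 * Real.pi * I) - c)‖ := by ring_nf
      _ ≤ _ := norm_add_le _ _
      _ ≤ T / 100 / 8 := by linarith [abs_nonneg (Real.log ‖C‖)]
  · have hX' : X ∈ ball c (T / 50) := ball_subset_ball (by linarith) hX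
    simp only [exp_add, exp_int_mul_two_pi_mul_I, mul_one]
    rw [hh X hX']
    simp only [hk]
    field_simp

open Complex Metric Set Filter in
/-- Solutions of the two difference equations attached to a nonconstant entire function. -/
theorem exists_solutions {g : ℂ → ℂ} (hg : Differentiable ℂ g)
    (hnc : ¬ ∃ c : ℂ, ∀ z : ℂ, g z = c) {D : ℂ} (hD : D ≠ 0) (B : ℝ) :
    (∃ x y : ℂ, g y = g x + Real.pi * I ∧ y - x = D * exp (g x)) ∧
    (∃ x y x' y' : ℂ, B ≤ ‖g x‖ ∧ g y = g x + Real.pi * I ∧ g y' = g x' + Real.pi * I ∧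
      y - x = D * exp (g x') ∧ y' - x' = -D * exp (g x)) := by
  set G : ℂ → ℂ := fun z => g z - g 0 with hG
  have hgG : ∀ z, g z = g 0 + G z := fun z => by simp [hG]
  set C := D * exp (g 0) with hC
  have hC0 : C ≠ 0 := mul_ne_zero hD (exp_ne_zero _)
  have hGnc : ∃ z, G z ≠ 0 := by
    by_contra! h
    exact hnc ⟨g 0, fun z => sub_eq_zero.1 (h z)⟩
  have hlarge : ∀ᶠ T : ℝ in atTop, 100 + 10 * Real.log T + |Real.log ‖C‖| ≤ T / 1000 := by
    have h1 := Real.isLittleO_log_id_atTop.def (c := 1 / 20000) (by norm_num)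
    filter_upwards [h1, eventually_ge_atTop (2000 * (100 + |Real.log ‖C‖|)),
      eventually_ge_atTop 1] with T h2 h3 h4
    simp only [id, Real.norm_eq_abs] at h2
    rw [abs_of_nonneg (Real.log_nonneg h4), abs_of_pos (by linarith : 0 < T)] at h2
    linarith
  obtain ⟨T₀, hT₀⟩ := hlarge.exists_forall_of_atTop
  -- The entry 2(B + |g 0|) forces |g x| ≥ B, because g x = g 0 + X with |X - iT| ≤ T/800.
  obtain ⟨T, hTB, φ, hφ, hφg, hlow⟩ := exists_large_inverse_branch (g := G) (hg.sub_const _)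
    (by simp [hG]) hGnc (max (max T₀ 1) (2 * (B + ‖g 0‖)))
  simp only [ge_iff_le, max_le_iff] at hTB
  obtain ⟨⟨hT1, hT2⟩, hT3⟩ := hTB
  have hTC := hT₀ T hT1
  have hC' : -C ≠ 0 := neg_ne_zero.2 hC0
  obtain ⟨h₁, hd₁, hm₁, he₁⟩ := exists_log_difference hC0 hTC hT2 hφ hφg hlow
  obtain ⟨h₂, hd₂, hm₂, he₂⟩ := exists_log_difference hC' (by rwa [norm_neg]) hT2 hφ hφg hlow
  have hr : 0 < T / 100 := by linarith
  have hT100 : 100000 ≤ T := by linarith [abs_nonneg (Real.log ‖C‖), Real.log_nonneg hT2]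
  set c : ℂ := T * I with hc
  have hsub : closedBall c (T / 100 / 8) ⊆ ball c (T / 100) := closedBall_subset_ball (by linarith)
  have hshift : ∀ X ∈ ball c (T / 100), X ∈ ball c (T / 40) ∧
      X + Real.pi * I ∈ ball c (T / 40) := by
    intro X hX
    refine ⟨ball_subset_ball (by linarith) hX, ?_⟩
    rw [mem_ball_iff_norm] at *
    have hπn : ‖(Real.pi : ℂ) * I‖ = Real.pi := by
      rw [norm_mul, norm_I, norm_real, mul_one, Real.norm_of_nonneg Real.pi_pos.le]
    calc ‖X + Real.pi * I - c‖ = ‖(X - c) + Real.pi * I‖ := by ring_nf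
      _ ≤ ‖X - c‖ + Real.pi := (norm_add_le _ _).trans (by rw [hπn])
      _ < _ := by linarith [Real.pi_lt_four]
  have hgX : ∀ X ∈ ball c (T / 100), g (φ X) = g 0 + X ∧
      g (φ (X + Real.pi * I)) = g (φ X) + Real.pi * I := by
    intro X hX
    obtain ⟨h1, h2⟩ := hshift X hX
    rw [hgG (φ X), hgG (φ (X + _)), (hφg _ h1).1, (hφg _ h2).1]
    exact ⟨rfl, by ring⟩
  constructor
  · obtain ⟨X, hX, hfix⟩ := exists_fixedPoint_of_mapsTo_ball hr hd₁ hm₁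
    refine ⟨φ X, φ (X + Real.pi * I), (hgX X (hsub hX)).2, ?_⟩
    rw [he₁ X (hsub hX), hfix, (hgX X (hsub hX)).1, hC, exp_add, mul_assoc]
  -- With X' = h₁ X and h₂ X' = X, the two differences are C exp(X') and -C exp(X), which is the
  -- coupled system.
  · have hm₁' : MapsTo h₁ (ball c (T / 100)) (ball c (T / 100)) := hm₁.mono_right hsub
    obtain ⟨X, hX, hfix⟩ := exists_fixedPoint_of_mapsTo_ball hr (hd₂.comp hd₁ hm₁')
      (hm₂.comp hm₁')
    have hX' := hm₁' (hsub hX)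
    refine ⟨φ X, φ (X + Real.pi * I), φ (h₁ X), φ (h₁ X + Real.pi * I), ?_,
      (hgX X (hsub hX)).2, (hgX _ hX').2, ?_, ?_⟩
    · rw [(hgX X (hsub hX)).1]
      rw [mem_closedBall_iff_norm] at hX
      have h1 : ‖c‖ = T := by
        rw [hc, norm_mul, norm_I, norm_real, mul_one, Real.norm_of_nonneg (by linarith)]
      have h2 : ‖c‖ ≤ ‖g 0 + X‖ + ‖g 0‖ + ‖X - c‖ := by
        calc ‖c‖ = ‖(g 0 + X) - g 0 - (X - c)‖ := by ring_nf
          _ ≤ ‖(g 0 + X) - g 0‖ + ‖X - c‖ := norm_sub_le _ _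
          _ ≤ _ := by gcongr; exact norm_sub_le _ _
      linarith
    · rw [he₁ X (hsub hX), (hgX _ hX').1, hC, exp_add, mul_assoc]
    · have h3 : h₂ (h₁ X) = X := hfix
      rw [he₂ _ hX', h3, (hgX X (hsub hX)).1, hC, exp_add]
      ring

/-! ### Cycles of Hénon maps -/

-- The orbit is (x, y') → (x', x) → (y, x') → (y', y) → (x, y'), the sign changes of exp ∘ g closing
-- it up. Its second iterate differs from the start since y - x is an exponential, and a divisor of
-- 4 not dividing 2 is 4.
open Complex in
theorem minimalPeriod_henon_exp_eq_four {g : ℂ → ℂ} {x y x' y' : ℂ}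
    (hy : g y = g x + Real.pi * I) (hy' : g y' = g x' + Real.pi * I)
    (h1 : y - x = exp (g x')) (h2 : y' - x' = -exp (g x)) :
    Function.minimalPeriod (fun q : ℂ × ℂ => (exp (g q.1) + q.2, q.1)) (x, y') = 4 := by
  set F : ℂ × ℂ → ℂ × ℂ := fun q => (exp (g q.1) + q.2, q.1) with hF
  have ey : exp (g y) = -exp (g x) := by rw [hy, exp_add, exp_pi_mul_I]; ring
  have ey' : exp (g y') = -exp (g x') := by rw [hy', exp_add, exp_pi_mul_I]; ring
  have f1 : F (x, y') = (x', x) := by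
    simp only [hF, Prod.mk.injEq, and_true]; linear_combination h2
  have f2 : F (x', x) = (y, x') := by
    simp only [hF, Prod.mk.injEq, and_true]; linear_combination -h1
  have f3 : F (y, x') = (y', y) := by
    simp only [hF, Prod.mk.injEq, and_true]; linear_combination ey - h2
  have f4 : F (y', y) = (x, y') := by
    simp only [hF, Prod.mk.injEq, and_true]; linear_combination ey' + h1
  have hp : Function.IsPeriodicPt F (2 ^ (1 + 1)) (x, y') := by
    change F^[4] (x, y') = (x, y')
    simp only [Function.iterate_succ, Function.iterate_zero, Function.comp, f1, f2, f3, f4, id]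
  have hnp : ¬ Function.IsPeriodicPt F (2 ^ 1) (x, y') := by
    intro h
    have h5 : F^[2] (x, y') = (x, y') := h
    simp only [Function.iterate_succ, Function.iterate_zero, Function.comp, f1, f2, id,
      Prod.mk.injEq] at h5
    rw [h5.1, sub_self] at h1
    exact exp_ne_zero _ h1.symm
  exact Function.minimalPeriod_eq_prime_pow hnp hp

-- Solutions of the coupled system exist with |g x| arbitrarily large, whereas a finite set would
-- bound this quantity.
open Complex in
theorem infinite_minimalPeriod_henon_exp_eq_four {g : ℂ → ℂ} (hg : Differentiable ℂ g)
    (hnc : ¬ ∃ c : ℂ, ∀ z : ℂ, g z = c) :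
    {p : ℂ × ℂ | Function.minimalPeriod
        (fun q : ℂ × ℂ => (exp (g q.1) + q.2, q.1)) p = 4}.Infinite := by
  intro hfin
  obtain ⟨M, hM⟩ := (hfin.image fun p => ‖g p.1‖).bddAbove
  obtain ⟨x, y, x', y', hB, hy, hy', h1, h2⟩ := (exists_solutions hg hnc one_ne_zero (M + 1)).2
  have := hM ⟨(x, y'), minimalPeriod_henon_exp_eq_four hy hy' (by simpa using h1)
    (by simpa using h2), rfl⟩
  simp only at this
  linarith

open Complex in
theorem exists_minimalPeriod_henon {f : ℂ → ℂ} {δ : ℂ} (hf : IsTranscendentalEntire f) :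
    ∃ p : ℂ × ℂ, Function.minimalPeriod (henonMap f δ) p = 1 ∨
      Function.minimalPeriod (henonMap f δ) p = 2 ∨
        Function.minimalPeriod (henonMap f δ) p = 4 := by
  obtain ⟨hfd, hfp⟩ := hf
  by_cases hfix : ∃ z, f z = (1 + δ) * z
  · obtain ⟨z, hz⟩ := hfix
    refine ⟨(z, z), Or.inl ?_⟩
    rw [Function.minimalPeriod_eq_one_iff_isFixedPt]
    change (f z - δ * z, z) = (z, z)
    rw [hz]
    ring_nf
  push Not at hfix
  -- Without fixed points f(z) - (1 + δ)z has no zeros; transcendence of f then prevents g from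
  -- being constant.
  obtain ⟨g, hgd, hg⟩ := exists_exp_eq_of_entire (f := fun z => f z - (1 + δ) * z)
    (by fun_prop) (fun z => sub_ne_zero.2 (hfix z))
  have hfg : ∀ z, f z = (1 + δ) * z + exp (g z) := fun z => by rw [hg]; ring
  have hnc : ¬ ∃ c : ℂ, ∀ z : ℂ, g z = c := by
    rintro ⟨c, hc⟩
    exact hfp ⟨Polynomial.C (1 + δ) * Polynomial.X + Polynomial.C (exp c), fun z => by
      simp [hfg, hc]⟩
  by_cases hδ : 1 + δ = 0
  · obtain ⟨p, hp⟩ := (infinite_minimalPeriod_henon_exp_eq_four hgd hnc).nonempty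
    refine ⟨p, Or.inr (Or.inr ?_)⟩
    have hδ' : δ = -1 := by linear_combination hδ
    have : henonMap f δ = fun q : ℂ × ℂ => (exp (g q.1) + q.2, q.1) := by
      funext q
      simp [henonMap, hfg, hδ']
    rw [this]
    exact hp
  · obtain ⟨x, y, hy, hxy⟩ := (exists_solutions hgd hnc (inv_ne_zero hδ) 0).1
    have ey : exp (g y) = -exp (g x) := by rw [hy, exp_add, exp_pi_mul_I]; ring
    have hxy' : (1 + δ) * (y - x) = exp (g x) := by rw [hxy]; field_simp
    refine ⟨(x, y), Or.inr (Or.inl ?_)⟩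
    have f1 : henonMap f δ (x, y) = (y, x) := by
      simp only [henonMap, hfg, Prod.mk.injEq, and_true]; linear_combination -hxy'
    have f2 : henonMap f δ (y, x) = (x, y) := by
      simp only [henonMap, hfg, Prod.mk.injEq, and_true]; linear_combination ey + hxy'
    refine Function.minimalPeriod_eq_prime (hp := ⟨Nat.prime_two⟩) ?_ ?_
    · change henonMap f δ (henonMap f δ (x, y)) = (x, y)
      rw [f1, f2]
    · intro h
      have h5 : henonMap f δ (x, y) = (x, y) := h
      rw [f1, Prod.mk.injEq] at h5
      rw [h5.1, sub_self, mul_zero] at hxy'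
      exact exp_ne_zero _ hxy'.symm

theorem mainTheorem4 :
    (∀ F : ℂ × ℂ → ℂ × ℂ, IsTranscendentalHenon F →
      ∃ p ∈ Function.periodicPts F,
        Function.minimalPeriod F p = 1 ∨ Function.minimalPeriod F p = 2 ∨
          Function.minimalPeriod F p = 4) ∧
    (∀ g : ℂ → ℂ, Differentiable ℂ g → (¬ ∃ c : ℂ, ∀ z : ℂ, g z = c) →
      {p : ℂ × ℂ | Function.minimalPeriod
        (fun q : ℂ × ℂ => (Complex.exp (g q.1) + q.2, q.1)) p = 4}.Infinite) := by
  refine ⟨?_, fun g hg hnc => infinite_minimalPeriod_henon_exp_eq_four hg hnc⟩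
  rintro F ⟨f, δ, hf, -, rfl⟩
  obtain ⟨p, hp⟩ := exists_minimalPeriod_henon (δ := δ) hf
  -- `Function.minimalPeriod` takes the value 0 exactly at non-periodic points, so a value 1, 2 or 4
  -- certifies periodicity.
  refine ⟨p, Function.minimalPeriod_pos_iff_mem_periodicPts.1 ?_, hp⟩
  rcases hp with h | h | h <;> omega
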